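/- Write $x^y=y^{-1}xy$, $x^{ky}=y^{-1}x^ky$ and $[x,y]=x^{-1}y^{-1}xy$ for elements $x,y$ of a group and $k\in\mathbb Z$, and let $BS(n,m)=\langle c,d\mid c^{nd}=c^m\rangle$ be the Baumslag–Solitar groups. **No-bottle lemma.** Let $$G=\langle a,c,d\mid [a,[c^d,c]]=1,\ c^{3d}=c^5\rangle .$$ The element $b$ of the free abelian group $\langle a,b\mid [a,b]=1\rangle$ and the element $[c^d,c]$ of $BS(3,5)$ have infinite order, and $G$ is the amalgamated free product $$G=\langle a,b\mid [a,b]=1\rangle \underset{b=[c^d,c]}{*} BS(3,5)$$ (more precisely, there is an isomorphism from $G$ onto the amalgamated product taking the generators $a$, $c$, $d$ to the elements of the same name). The group $G$ contains no subgroup isomorphic to the Klein-bottle group $BS(1,-1)=\langle c,d\mid c^{d}=c^{-1}\rangle$. -/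

import Mathlib

namespace NoBottle

/-- The conjugate `x ^ y = y⁻¹ x y`. -/
def conj {G : Type*} [Group G] (x y : G) : G := y⁻¹ * x * y

/-- The commutator `[x, y] = x⁻¹ y⁻¹ x y`. -/
def comm {G : Type*} [Group G] (x y : G) : G := x⁻¹ * y⁻¹ * x * y

/-- The Baumslag–Solitar group `BS(n, m) = ⟨c, d | d⁻¹ cⁿ d = cᵐ⟩`; the letters `0` and `1` of
the free group are `c` and `d`. -/
abbrev BS (n m : ℤ) : Type :=
  PresentedGroup
    ({conj (FreeGroup.of 0 ^ n) (FreeGroup.of 1) * (FreeGroup.of 0 ^ m)⁻¹} :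
      Set (FreeGroup (Fin 2)))

/-- The generator `c` of `BS(n, m)`. -/
def BS.c (n m : ℤ) : BS n m := PresentedGroup.of 0

/-- The generator `d` of `BS(n, m)`. -/
def BS.d (n m : ℤ) : BS n m := PresentedGroup.of 1

/-- The Klein-bottle group `BS(1, -1)`. -/
abbrev KleinBottleGroup : Type := BS 1 (-1)

/-- The free abelian group `⟨a, b | [a, b] = 1⟩`; the letters `0` and `1` of the free group are
`a` and `b`. -/
abbrev FreeAb : Type :=
  PresentedGroup
    ({comm (FreeGroup.of 0) (FreeGroup.of 1)} : Set (FreeGroup (Fin 2)))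

/-- The generator `a` of `⟨a, b | [a, b] = 1⟩`. -/
def FreeAb.a : FreeAb := PresentedGroup.of 0

/-- The generator `b` of `⟨a, b | [a, b] = 1⟩`. -/
def FreeAb.b : FreeAb := PresentedGroup.of 1

/-- The element `h = [c ^ d, c]` of `BS(3, 5)`. -/
def h : BS 3 5 := comm (conj (BS.c 3 5) (BS.d 3 5)) (BS.c 3 5)

/-- The group `G = ⟨a, c, d | [a, [c ^ d, c]] = 1, d⁻¹ c³ d = c⁵⟩`; the letters `0`, `1`, `2` of
the free group are `a`, `c`, `d`. -/
abbrev G : Type :=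
  PresentedGroup
    ({comm (FreeGroup.of 0)
        (comm (conj (FreeGroup.of 1) (FreeGroup.of 2)) (FreeGroup.of 1)),
      conj (FreeGroup.of 1 ^ 3) (FreeGroup.of 2) * (FreeGroup.of 1 ^ 5)⁻¹} :
      Set (FreeGroup (Fin 3)))

/-- The generator `a` of `G`. -/
def G.a : G := PresentedGroup.of 0

/-- The generator `c` of `G`. -/
def G.c : G := PresentedGroup.of 1

/-- The generator `d` of `G`. -/
def G.d : G := PresentedGroup.of 2

/-- The two-member family of types with members `A` (at `false`) and `B` (at `true`). -/
def Factor (A B : Type) : Bool → Type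
  | false => A
  | true => B

instance Factor.group (A B : Type) [Group A] [Group B] : ∀ i, Group (Factor A B i)
  | false => inferInstanceAs (Group A)
  | true => inferInstanceAs (Group B)

/-- The two homomorphisms from the infinite cyclic group to `A` and `B` that send its generator
to `x` and to `y`. -/
def cyclicMaps {A B : Type} [Group A] [Group B] (x : A) (y : B) :
    ∀ i, Multiplicative ℤ →* Factor A B i
  | false => zpowersHom A x
  | true => zpowersHom B y

/-- The free product of `A` and `B` with `x ∈ A` and `y ∈ B` identified: the pushout of `A` and
`B` over the infinite cyclic group. When `x` and `y` have infinite order, this is the amalgamated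
free product of `A` and `B` over `⟨x⟩ ≅ ⟨y⟩`, `x = y`. -/
abbrev CyclicAmalgam {A B : Type} [Group A] [Group B] (x : A) (y : B) : Type :=
  Monoid.PushoutI (cyclicMaps x y)

/-- The canonical homomorphism from the first factor. -/
def CyclicAmalgam.inl {A B : Type} [Group A] [Group B] (x : A) (y : B) :
    A →* CyclicAmalgam x y :=
  Monoid.PushoutI.of (φ := cyclicMaps x y) false

/-- The canonical homomorphism from the second factor. -/
def CyclicAmalgam.inr {A B : Type} [Group A] [Group B] (x : A) (y : B) :
    B →* CyclicAmalgam x y :=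
  Monoid.PushoutI.of (φ := cyclicMaps x y) true

end NoBottle

/-! The reason is that square roots in `G` are unique. The Klein-bottle relation gives `c * d * c =
d`, so `d * c` and `d` have the same square. If squaring is injective, then `c = 1`, which is false
in the Klein-bottle group.

Uniqueness of roots passes up two HNN extensions: `BS(3, 5)` over `ℤ`, then `G` over `BS(3, 5)` with
the stable letter `a` centralising `h = [c ^ d, c]`. Each acts without inversions on its Bass–Serre
tree. Let `y * y = z * z`. If `y` is hyperbolic, then `z` translates the same axis by the same
amount. If `y` fixes a vertex, then `z` is elliptic too, and it fixes that vertex as well, provided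
edge stabilisers are closed under square roots. Either way, after a conjugation, `y⁻¹ * z` lies in
the base group (`IsTreeLength.mul_self_injective`).

For `BS(3, 5)`, edge stabilisers are closed under roots because 3 and 5 are odd, and the base-group
ambiguity is removed by an action on `ℚ` by increasing affine maps. For `G`, closure holds because
`h` is not a square in `BS(3, 5)` (`h_ne_mul_self`), and the ambiguity is removed by the retraction
`a ↦ 1` onto `BS(3, 5)`. -/

/-- A length function on a group that comes from the displacement of a base point of a tree:
`L (x⁻¹ * y)` is the distance of the translates of the base point by `x` and by `y`. -/
structure IsTreeLength {Γ : Type*} [Group Γ] (L : Γ → ℕ) : Prop where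
  one : L 1 = 0
  inv : ∀ x, L x⁻¹ = L x
  four_point : ∀ x y z, L y + L (x⁻¹ * z) ≤ max (L z + L (x⁻¹ * y)) (L x + L (y⁻¹ * z))
  exists_first : ∀ y n, L y = n + 1 → ∃ s, L s = 1 ∧ L (s⁻¹ * y) = n
  even_mul : ∀ x y, Even (L (x * y) + L x + L y)
  sq_ne_zero : ∀ y, L y = 1 → L (y * y) ≠ 0

/-! ### Displacement, axes and square roots for actions on trees -/

namespace IsTreeLength

variable {Γ : Type*} [Group Γ] {L : Γ → ℕ}

lemma mul_le (hL : IsTreeLength L) (x y : Γ) : L (x * y) ≤ L x + L y := by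
  have h := hL.four_point x⁻¹ 1 y
  simp [hL.one, hL.inv] at h
  omega

lemma mul_eq_zero (hL : IsTreeLength L) {x y : Γ} (hx : L x = 0) (hy : L y = 0) :
    L (x * y) = 0 := by
  have := hL.mul_le x y
  omega

lemma mul_left_eq (hL : IsTreeLength L) {x : Γ} (hx : L x = 0) (y : Γ) : L (x * y) = L y := by
  have h1 := hL.mul_le x y
  have h2 := hL.mul_le x⁻¹ (x * y)
  rw [inv_mul_cancel_left, hL.inv] at h2
  omega

lemma mul_right_eq (hL : IsTreeLength L) (x : Γ) {y : Γ} (hy : L y = 0) : L (x * y) = L x := by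
  have h1 := hL.mul_le x y
  have h2 := hL.mul_le (x * y) y⁻¹
  rw [mul_inv_cancel_right, hL.inv] at h2
  omega

/-- The condition `L (y * y) = 2 * L y` says that the base point lies on the axis of `y`. The
four-point condition first gives `L (y ^ 3) ≥ 3 * L y`, then the bound for the fourth power. -/
lemma sq_sq (hL : IsTreeLength L) {y : Γ} (h0 : 0 < L y) (h : L (y * y) = 2 * L y) :
    L ((y * y) * (y * y)) = 2 * L (y * y) := by
  have h1 := hL.four_point y (y * y) (y * y)⁻¹
  have h2 := hL.four_point y (y * y)⁻¹ y⁻¹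
  have e1 : y⁻¹ * (y * y)⁻¹ = (y * y * y)⁻¹ := by group
  have e2 : y⁻¹ * (y * y) = y := by group
  have e3 : (y * y)⁻¹ * (y * y)⁻¹ = ((y * y) * (y * y))⁻¹ := by group
  have e4 : y⁻¹ * y⁻¹ = (y * y)⁻¹ := by group
  have e5 : ((y * y)⁻¹)⁻¹ * y⁻¹ = y := by group
  rw [e1, e2, e3] at h1
  rw [e1, e4, e5] at h2
  simp only [hL.inv] at h1 h2
  have h3 := hL.mul_le (y * y) (y * y)
  omega

lemma pow_two_pow (hL : IsTreeLength L) {y : Γ} (h0 : 0 < L y) (h : L (y * y) = 2 * L y)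
    (j : ℕ) : L (y ^ 2 ^ j) = 2 ^ j * L y := by
  have key : L (y ^ 2 ^ j) = 2 ^ j * L y ∧
      L (y ^ 2 ^ j * y ^ 2 ^ j) = 2 * L (y ^ 2 ^ j) := by
    induction j with
    | zero => simpa using h
    | succ j ih =>
      have e : y ^ 2 ^ (j + 1) = y ^ 2 ^ j * y ^ 2 ^ j := by rw [← pow_add, pow_succ, mul_two]
      have hpos : 0 < L (y ^ 2 ^ j) := by rw [ih.1]; positivity
      refine ⟨by rw [e, ih.2, ih.1]; ring, ?_⟩
      rw [e]
      exact hL.sq_sq hpos ih.2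
  exact key.1

/-- The base point lies on the axis of `z * z`, hence on that of `z`. Algebraically, one four-point
inequality bounds `L (z ^ 3)` below by `L z + 2 * n`, and the other then forces `L z ≤ n`. -/
lemma sqrt_length (hL : IsTreeLength L) {z : Γ} {n : ℕ} (hn : 0 < n) (h2 : L (z * z) = 2 * n)
    (h4 : L ((z * z) * (z * z)) = 4 * n) : L z = n := by
  have h1 := hL.four_point (z * z) z z⁻¹
  have h3 := hL.four_point (z * z) z⁻¹ (z * z)⁻¹
  have e1 : (z * z)⁻¹ * z⁻¹ = (z * z * z)⁻¹ := by group
  have e2 : (z * z)⁻¹ * z = z⁻¹ := by group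
  have e3 : z⁻¹ * z⁻¹ = (z * z)⁻¹ := by group
  have e4 : (z * z)⁻¹ * (z * z)⁻¹ = ((z * z) * (z * z))⁻¹ := by group
  have e5 : (z⁻¹)⁻¹ * (z * z)⁻¹ = z⁻¹ := by group
  rw [e1, e2, e3] at h1
  rw [e1, e4, e5] at h3
  simp only [hL.inv] at h1 h3
  have h5 := hL.mul_le z z
  omega

/-- A geodesic has only one point at a given distance from its start. -/
lemma inv_mul_eq_zero (hL : IsTreeLength L) {x y w : Γ} {n m : ℕ} (hw : L w = n + m)
    (hx : L x = n) (hy : L y = n) (hxw : L (x⁻¹ * w) = m) (hyw : L (y⁻¹ * w) = m) :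
    L (x⁻¹ * y) = 0 := by
  have h := hL.four_point x w y
  have e : w⁻¹ * y = (y⁻¹ * w)⁻¹ := by group
  rw [e, hL.inv] at h
  omega

/-- An element that fixes a translate of the base point. -/
def Elliptic (L : Γ → ℕ) (y : Γ) : Prop := ∃ p, L (p⁻¹ * y * p) = 0

/-- A translate of the base point with least displacement lies on the axis. Otherwise the geodesics
at `x` times the base point backtrack, and the first vertex `s` towards it is moved less. -/
lemma exists_conj_sq (hL : IsTreeLength L) {y : Γ} (hy : ¬ Elliptic L y) :
    ∃ p, 0 < L (p⁻¹ * y * p) ∧ L ((p⁻¹ * y * p) * (p⁻¹ * y * p)) = 2 * L (p⁻¹ * y * p) := by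
  obtain ⟨p, -, hp⟩ := (measure fun p => L (p⁻¹ * y * p)).wf.has_min Set.univ ⟨1, trivial⟩
  have hmin : ∀ q, L (p⁻¹ * y * p) ≤ L (q⁻¹ * (p⁻¹ * y * p) * q) := by
    intro q
    have := hp (p * q) trivial
    rw [show q⁻¹ * (p⁻¹ * y * p) * q = (p * q)⁻¹ * y * (p * q) by group]
    exact not_lt.1 this
  have hpos : L (p⁻¹ * y * p) ≠ 0 := fun h => hy ⟨p, h⟩
  refine ⟨p, Nat.pos_of_ne_zero hpos, ?_⟩
  generalize p⁻¹ * y * p = x at hmin hpos ⊢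
  obtain ⟨m, hm⟩ := Nat.exists_eq_succ_of_ne_zero hpos
  obtain ⟨s, hs, hsx⟩ := hL.exists_first x m hm
  by_contra hne
  have hle := hL.mul_le x x
  obtain ⟨k, hk⟩ := hL.even_mul x x
  -- For displacement 1, parity leaves only `L (x * x) = 0`, which would be an inversion of an edge.
  rcases Nat.eq_zero_or_pos m with rfl | hmpos
  · exact hL.sq_ne_zero x hm (by omega)
  have f1 := hL.four_point s x x⁻¹
  have f2 := hL.four_point s x (x * s)
  have e1 : s⁻¹ * x⁻¹ = (x * s)⁻¹ := by group
  have e2 : x⁻¹ * x⁻¹ = (x * x)⁻¹ := by group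
  have e3 : x⁻¹ * (x * s) = s := by group
  rw [hsx, e1, e2] at f1
  rw [hsx, e3, ← mul_assoc] at f2
  simp only [hL.inv] at f1
  have := hmin s
  omega

/-- The fixed set of `u * u` contains the geodesic between any two of its points. The hypothesis
`isol` carries the fixed points of `u` along that geodesic, one edge at a time. -/
lemma sq_eq_zero (hL : IsTreeLength L)
    (isol : ∀ s u, L s = 1 → L u = 0 → L (s * (u * u) * s⁻¹) = 0 → L (s * u * s⁻¹) = 0)
    (p u : Γ) (hu : L u = 0) (h : L (p * (u * u) * p⁻¹) = 0) : L (p * u * p⁻¹) = 0 := by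
  induction hn : L p generalizing p u with
  | zero => exact hL.mul_eq_zero (hL.mul_eq_zero hn hu) (by rw [hL.inv, hn])
  | succ n ih =>
    obtain ⟨s, hs, hsp⟩ := hL.exists_first p⁻¹ n (by rw [hL.inv, hn])
    have huu : L (u * u) = 0 := hL.mul_eq_zero hu hu
    have h1 : L (s⁻¹ * (u * u) * s) = 0 := by
      have f1 := hL.four_point s p⁻¹ (u * u * s)
      have f2 := hL.mul_le (p * (u * u) * p⁻¹) (p * s)
      have e1 : s⁻¹ * (u * u * s) = s⁻¹ * (u * u) * s := by group
      have e2 : (p⁻¹)⁻¹ * (u * u * s) = p * (u * u) * p⁻¹ * (p * s) := by group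
      have e3 : p * s = (s⁻¹ * p⁻¹)⁻¹ := by group
      rw [e1, e2, hsp, hL.inv, hL.mul_left_eq huu] at f1
      rw [h, e3, hL.inv, hsp] at f2
      rw [e3] at f1
      omega
    have h2 : L (s⁻¹ * u * s) = 0 := by
      simpa using isol s⁻¹ u (by rw [hL.inv, hs]) hu (by simpa using h1)
    have := ih (p * s) (s⁻¹ * u * s) h2 (by
      rw [← h]; congr 1; group) (by rw [← hsp, ← hL.inv]; congr 1; group)
    rw [← this]; congr 1; group

/-- A bounded orbit excludes an axis: the powers of a hyperbolic element have unbounded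
displacement. -/
lemma Elliptic.of_sq (hL : IsTreeLength L) {y : Γ} (h : L (y * y) = 0) : Elliptic L y := by
  by_contra hy
  obtain ⟨p, h0, h2⟩ := hL.exists_conj_sq hy
  set x := p⁻¹ * y * p with hx
  have hpow : ∀ k, L ((y * y) ^ k) = 0 := by
    intro k
    induction k with
    | zero => simpa using hL.one
    | succ k ih => rw [pow_succ]; exact hL.mul_eq_zero ih h
  have hle : ∀ j, L (x ^ 2 ^ (j + 1)) ≤ 2 * L p := by
    intro j
    have e : x ^ 2 ^ (j + 1) = p⁻¹ * (y * y) ^ 2 ^ j * p := by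
      have := conj_pow (i := 2 ^ (j + 1)) (a := p⁻¹) (b := y)
      rw [inv_inv] at this
      rw [hx, this, pow_succ 2 j, mul_comm (2 ^ j) 2, pow_mul, pow_two]
    have f1 := hL.mul_le (p⁻¹ * (y * y) ^ 2 ^ j) p
    rw [e]
    rw [hL.mul_right_eq _ (hpow _), hL.inv] at f1
    omega
  -- Any exponent `k` with `2 ^ (k + 1) > 2 * L p` would do.
  have h3 := hle (2 * L p)
  rw [hL.pow_two_pow h0 h2] at h3
  have h4 : 2 * L p + 1 < 2 ^ (2 * L p + 1) := Nat.lt_two_pow_self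
  have h5 := Nat.mul_le_mul_left (2 ^ (2 * L p + 1)) h0
  omega

/-- In a group acting on a tree without inversions, squaring is injective as soon as it is
injective on vertex stabilisers and edge stabilisers are closed under square roots in the vertex
stabilisers. -/
theorem mul_self_injective (hL : IsTreeLength L)
    (isol : ∀ s u, L s = 1 → L u = 0 → L (s * (u * u) * s⁻¹) = 0 → L (s * u * s⁻¹) = 0)
    (vert : ∀ y z : Γ, y * y = z * z → L (y⁻¹ * z) = 0 → y = z) (y z : Γ)
    (h : y * y = z * z) : y = z := by
  have conj_sq : ∀ p : Γ, (p⁻¹ * y * p) * (p⁻¹ * y * p) = (p⁻¹ * z * p) * (p⁻¹ * z * p) := by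
    intro p
    calc _ = p⁻¹ * (y * y) * p := by group
      _ = p⁻¹ * (z * z) * p := by rw [h]
      _ = _ := by group
  suffices ∃ p, L ((p⁻¹ * y * p)⁻¹ * (p⁻¹ * z * p)) = 0 by
    obtain ⟨p, hp⟩ := this
    have := vert _ _ (conj_sq p) hp
    simpa using this
  by_cases hy : Elliptic L y
  · obtain ⟨p, hp⟩ := hy
    refine ⟨p, hL.mul_eq_zero (by rw [hL.inv, hp]) ?_⟩
    have hz2 : L ((p⁻¹ * z * p) * (p⁻¹ * z * p)) = 0 := by
      rw [← conj_sq]; exact hL.mul_eq_zero hp hp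
    -- The conjugate of `z` fixes the translate by `q` and its square fixes the base point, so it
    -- fixes the whole geodesic between them.
    obtain ⟨q, hq⟩ := Elliptic.of_sq hL hz2
    have := hL.sq_eq_zero isol q _ hq (by rw [← hz2]; congr 1; group)
    rw [← this]; congr 1; group
  · obtain ⟨p, h0, h2⟩ := hL.exists_conj_sq hy
    refine ⟨p, ?_⟩
    have h4 := hL.sq_sq h0 h2
    have hz : L (p⁻¹ * z * p) = L (p⁻¹ * y * p) :=
      hL.sqrt_length h0 (by rw [← conj_sq, h2]) (by rw [← conj_sq, h4, h2]; ring)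
    -- Both roots send the base point to the midpoint of the geodesic from it to its image under the
    -- common square.
    refine hL.inv_mul_eq_zero (w := (p⁻¹ * y * p) * (p⁻¹ * y * p)) (by rw [h2, two_mul]) rfl hz
      (by rw [inv_mul_cancel_left]) ?_
    rw [conj_sq, inv_mul_cancel_left, hz]

end IsTreeLength

/-! ### The rooted tree of lists -/

open Classical in
/-- The length of the longest common prefix of two lists. -/
noncomputable def List.commonPrefixLength {α : Type*} : List α → List α → ℕ
  | a :: l, b :: m => if a = b then l.commonPrefixLength m + 1 else 0
  | _, _ => 0

namespace List

variable {α : Type*}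

@[simp]
lemma commonPrefixLength_nil_left (l : List α) : commonPrefixLength [] l = 0 := by
  cases l <;> rfl

@[simp]
lemma commonPrefixLength_nil_right (l : List α) : commonPrefixLength l [] = 0 := by
  cases l <;> rfl

lemma commonPrefixLength_comm (l m : List α) :
    l.commonPrefixLength m = m.commonPrefixLength l := by
  induction l generalizing m with
  | nil => simp
  | cons a l ih =>
    rcases m with _ | ⟨b, m⟩
    · simp
    by_cases h : a = b
    · simp [commonPrefixLength, ih m, h]
    · simp [commonPrefixLength, h, Ne.symm h]

lemma commonPrefixLength_le_left (l m : List α) : l.commonPrefixLength m ≤ l.length := by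
  induction l generalizing m with
  | nil => simp
  | cons a l ih =>
    cases m with
    | nil => simp
    | cons b m => simp only [commonPrefixLength]; split_ifs <;> simp [ih]

lemma commonPrefixLength_le_right (l m : List α) : l.commonPrefixLength m ≤ m.length :=
  commonPrefixLength_comm l m ▸ commonPrefixLength_le_left m l

/-- This ultrametric inequality is the four-point condition of the tree in disguise. -/
lemma min_commonPrefixLength_le (l m k : List α) :
    min (l.commonPrefixLength m) (m.commonPrefixLength k) ≤ l.commonPrefixLength k := by
  induction l generalizing m k with
  | nil => simp
  | cons a l ih =>
    rcases m with _ | ⟨b, m⟩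
    · simp
    rcases k with _ | ⟨c, k⟩
    · simp
    have := ih m k
    simp only [commonPrefixLength]
    split_ifs <;> simp_all

lemma eq_of_commonPrefixLength (l m : List α) (h1 : l.commonPrefixLength m = l.length)
    (h2 : l.commonPrefixLength m = m.length) : l = m := by
  induction l generalizing m with
  | nil => simpa [eq_comm] using h2
  | cons a l ih =>
    rcases m with _ | ⟨b, m⟩
    · simp at h1
    simp only [commonPrefixLength] at h1 h2
    split_ifs at h1 h2 with hab
    · simp at h1 h2
      rw [hab, ih m h1 h2]

lemma commonPrefixLength_concat (l : List α) (a : α) (m : List α) :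
    (l ++ [a]).commonPrefixLength m = l.commonPrefixLength m ∨
      (l ++ [a]).commonPrefixLength m = l.commonPrefixLength m + 1 ∧
        l.commonPrefixLength m = l.length := by
  induction l generalizing m with
  | nil =>
    rcases m with _ | ⟨b, m⟩
    · simp
    · by_cases h : a = b <;> simp [commonPrefixLength, h]
  | cons b l ih =>
    rcases m with _ | ⟨c, m⟩
    · simp
    · by_cases h : b = c
      · simpa [commonPrefixLength, h] using ih m
      · simp [commonPrefixLength, h]

/-- The distance of two lists in the tree in which every list `a :: l` is joined to `l`. -/
noncomputable def suffixDist (l m : List α) : ℕ :=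
  l.length + m.length - 2 * l.reverse.commonPrefixLength m.reverse

lemma suffixDist_add (l m : List α) :
    l.suffixDist m + 2 * l.reverse.commonPrefixLength m.reverse = l.length + m.length := by
  have h1 := commonPrefixLength_le_left l.reverse m.reverse
  have h2 := commonPrefixLength_le_right l.reverse m.reverse
  simp only [length_reverse] at h1 h2
  unfold suffixDist
  omega

lemma suffixDist_comm (l m : List α) : l.suffixDist m = m.suffixDist l := by
  rw [suffixDist, suffixDist, commonPrefixLength_comm, add_comm]

@[simp]
lemma suffixDist_nil (l : List α) : l.suffixDist [] = l.length := by simp [suffixDist]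

lemma eq_of_suffixDist_eq_zero {l m : List α} (h : l.suffixDist m = 0) : l = m := by
  have h0 := suffixDist_add l m
  have h1 := commonPrefixLength_le_left l.reverse m.reverse
  have h2 := commonPrefixLength_le_right l.reverse m.reverse
  simp only [length_reverse] at h1 h2
  exact reverse_injective
    (eq_of_commonPrefixLength _ _ (by simp; omega) (by simp; omega))

lemma suffixDist_self (l : List α) : l.suffixDist l = 0 := by
  suffices ∀ l : List α, l.commonPrefixLength l = l.length by
    have h := suffixDist_add l l
    rw [this, length_reverse] at h
    omega
  intro l
  induction l with
  | nil => simp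
  | cons a l ih => simp [commonPrefixLength, ih]

lemma suffixDist_four_point (k l m : List α) :
    l.length + k.suffixDist m ≤ max (m.length + k.suffixDist l) (k.length + l.suffixDist m) := by
  have h1 := suffixDist_add k l
  have h2 := suffixDist_add l m
  have h3 := suffixDist_add k m
  have h4 := min_commonPrefixLength_le k.reverse l.reverse m.reverse
  omega

lemma suffixDist_cons (a : α) (l m : List α) :
    (a :: l).suffixDist m = l.suffixDist m + 1 ∨ (a :: l).suffixDist m + 1 = l.suffixDist m := by
  have h1 := suffixDist_add l m
  have h2 := suffixDist_add (a :: l) m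
  have h3 := commonPrefixLength_concat l.reverse a m.reverse
  simp only [reverse_cons, length_cons] at h2
  omega

/-- This is the first step of a geodesic: whichever list extends beyond the common suffix can drop
its head. -/
lemma suffixDist_cons_or (l m : List α) (h : l ≠ m) :
    (∃ a k, l = a :: k ∧ k.suffixDist m + 1 = l.suffixDist m) ∨
      (∃ a k, m = a :: k ∧ l.suffixDist k + 1 = l.suffixDist m) := by
  have aux : ∀ (k m : List α) (a : α),
      (a :: k).reverse.commonPrefixLength m.reverse < (a :: k).length →
        k.suffixDist m + 1 = (a :: k).suffixDist m := by
    intro k m a hlt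
    have h1 := suffixDist_add k m
    have h2 := suffixDist_add (a :: k) m
    have h3 := commonPrefixLength_concat k.reverse a m.reverse
    simp only [reverse_cons, length_cons, length_reverse] at h2 h3 hlt
    omega
  by_cases h1 : l.reverse.commonPrefixLength m.reverse < l.length
  · left
    cases l with
    | nil => simp at h1
    | cons a k => exact ⟨a, k, rfl, aux k m a h1⟩
  by_cases h2 : l.reverse.commonPrefixLength m.reverse < m.length
  · right
    cases m with
    | nil => simp at h2
    | cons a k =>
      rw [commonPrefixLength_comm] at h2
      refine ⟨a, k, rfl, ?_⟩
      rw [suffixDist_comm l k, suffixDist_comm l, aux k l a h2]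
  · refine absurd (eq_of_suffixDist_eq_zero ?_) h
    have := suffixDist_add l m
    omega

end List

/-! ### The Bass–Serre tree of an HNN extension, through normal forms -/

namespace HNNExtension

variable {G : Type*} [Group G] {A B : Subgroup G} {φ : A ≃* B}

variable (φ) in
/-- The letters, without the head, of the normal form of an element of an HNN extension. -/
noncomputable def letters (d : NormalWord.TransversalPair G A B) (x : HNNExtension G A B φ) :
    List (ℤˣ × G) :=
  (NormalWord.equiv φ d x).toList

variable {d : NormalWord.TransversalPair G A B}

lemma letters_eq_of_prod (w : NormalWord d) : letters φ d (w.prod φ) = w.toList := by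
  rw [letters]
  exact congrArg (fun w => w.toList) ((NormalWord.equiv φ d).apply_symm_apply w)

lemma exists_normalWord (d : NormalWord.TransversalPair G A B) (x : HNNExtension G A B φ) :
    ∃ w : NormalWord d, w.prod φ = x ∧ w.toList = letters φ d x :=
  ⟨NormalWord.equiv φ d x, (NormalWord.equiv φ d).symm_apply_apply x, rfl⟩

/-- Together with `exists_eq_of_mul_of_letters_eq`, this identifies lists of letters with right
cosets of the base group, the vertices of the tree. -/
lemma letters_of_mul (g : G) (x : HNNExtension G A B φ) :
    letters φ d (of g * x) = letters φ d x := by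
  obtain ⟨w, rfl, hw⟩ := exists_normalWord d x
  rw [← NormalWord.prod_group_smul, letters_eq_of_prod, letters_eq_of_prod]
  rfl

lemma letters_one : letters φ d (1 : HNNExtension G A B φ) = [] := by
  rw [← NormalWord.prod_empty φ (d := d), letters_eq_of_prod]
  rfl

lemma letters_zpow_mul (u : ℤˣ) (x : HNNExtension G A B φ) :
    (∃ a, letters φ d (t ^ (u : ℤ) * x) = a :: letters φ d x) ∨
      ∃ a, letters φ d x = a :: letters φ d (t ^ (u : ℤ) * x) := by
  obtain ⟨w, rfl, hw⟩ := exists_normalWord d x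
  rw [← NormalWord.prod_unitsSMul, letters_eq_of_prod, letters_eq_of_prod]
  by_cases h : NormalWord.Cancels u w
  · right
    rw [NormalWord.unitsSMul, dif_pos h]
    cases w using NormalWord.consRecOn with
    | ofGroup => simp [NormalWord.Cancels] at h
    | cons g u' w h1 h2 ih => exact ⟨(u', w.head), by simp [NormalWord.unitsSMulWithCancel]⟩
  · left
    rw [NormalWord.unitsSMul, dif_neg h]
    exact ⟨_, rfl⟩

lemma exists_of_mul_zpow_mul {x : HNNExtension G A B φ} {a : ℤˣ × G} {l : List (ℤˣ × G)}
    (h : letters φ d x = a :: l) :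
    ∃ g y, x = of g * (t ^ (a.1 : ℤ) * y) ∧ letters φ d y = l := by
  obtain ⟨w, rfl, hw⟩ := exists_normalWord d x
  cases w using NormalWord.consRecOn with
  | ofGroup => rw [h] at hw; simp at hw
  | cons g u w h1 h2 ih =>
    simp only [h, NormalWord.cons_toList, List.cons.injEq] at hw
    refine ⟨g, w.prod φ, ?_, by rw [letters_eq_of_prod, hw.2]⟩
    rw [NormalWord.prod_cons, ← hw.1]

lemma exists_eq_of_of_letters_eq_nil {x : HNNExtension G A B φ} (h : letters φ d x = []) :
    ∃ g, x = of g := by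
  obtain ⟨w, rfl, hw⟩ := exists_normalWord d x
  rw [h] at hw
  exact ⟨w.head, by rw [NormalWord.ReducedWord.prod, hw]; simp⟩

lemma exists_eq_of_mul_of_letters_eq {x y : HNNExtension G A B φ}
    (h : letters φ d x = letters φ d y) : ∃ g, x = of g * y := by
  obtain ⟨w, rfl, hw⟩ := exists_normalWord d x
  obtain ⟨v, rfl, hv⟩ := exists_normalWord d y
  rw [letters_eq_of_prod, letters_eq_of_prod] at h
  refine ⟨w.head * v.head⁻¹, ?_⟩
  rw [NormalWord.ReducedWord.prod, NormalWord.ReducedWord.prod, h, ← mul_assoc, ← map_mul,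
    inv_mul_cancel_right]

variable (φ) in
/-- The number of stable letters in the normal form of an element of an HNN extension. -/
noncomputable def length (x : HNNExtension G A B φ) : ℕ :=
  (letters φ (Classical.arbitrary (NormalWord.TransversalPair G A B)) x).length

lemma length_zpow_mul_of (u : ℤˣ) (g : G) (x : HNNExtension G A B φ)
    (d : NormalWord.TransversalPair G A B) :
    (letters φ d (of g * (t ^ (u : ℤ) * x))).length = (letters φ d x).length + 1 ∨
    (letters φ d (of g * (t ^ (u : ℤ) * x))).length + 1 = (letters φ d x).length := by
  rw [letters_of_mul]
  rcases letters_zpow_mul (d := d) u x with ⟨a, h⟩ | ⟨a, h⟩ <;> simp [h]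

/-- Each stable letter of `x` moves the vertex of `y` along one edge; base-group factors do not move
it. -/
lemma suffixDist_letters_le (x y : HNNExtension G A B φ) :
    (letters φ d (x * y)).suffixDist (letters φ d y) ≤ (letters φ d x).length := by
  induction hl : letters φ d x generalizing x with
  | nil =>
    obtain ⟨g, rfl⟩ := exists_eq_of_of_letters_eq_nil hl
    rw [letters_of_mul, List.suffixDist_self, List.length_nil]
  | cons a l ih =>
    obtain ⟨g, z, rfl, hz⟩ := exists_of_mul_zpow_mul hl
    have h := ih z hz
    rw [mul_assoc, letters_of_mul, mul_assoc, List.length_cons]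
    rcases letters_zpow_mul (d := d) a.1 (z * y) with ⟨b, hb⟩ | ⟨b, hb⟩
    · rw [hb]
      have := List.suffixDist_cons b (letters φ d (z * y)) (letters φ d y)
      omega
    · rw [hb] at h
      have := List.suffixDist_cons b (letters φ d (t ^ (a.1 : ℤ) * (z * y))) (letters φ d y)
      omega

lemma length_letters_inv (x : HNNExtension G A B φ) :
    (letters φ d x⁻¹).length = (letters φ d x).length := by
  have aux : ∀ y : HNNExtension G A B φ, (letters φ d y).length ≤ (letters φ d y⁻¹).length := by
    intro y
    have h := suffixDist_letters_le (d := d) y⁻¹ y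
    rwa [inv_mul_cancel, letters_one, List.suffixDist_comm, List.suffixDist_nil] at h
  exact le_antisymm (by simpa using aux x⁻¹) (aux x)

/-- The upper bound follows a geodesic between the two lists, each edge of which costs at most one
stable letter. -/
lemma length_letters_mul_inv (x y : HNNExtension G A B φ) :
    (letters φ d (x * y⁻¹)).length = (letters φ d x).suffixDist (letters φ d y) := by
  refine le_antisymm ?_ ?_
  · induction hn : (letters φ d x).suffixDist (letters φ d y) generalizing x y with
    | zero =>
      obtain ⟨g, rfl⟩ := exists_eq_of_mul_of_letters_eq (List.eq_of_suffixDist_eq_zero hn)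
      rw [mul_inv_cancel_right, ← mul_one (of g), letters_of_mul, letters_one, List.length_nil]
    | succ n ih =>
      have aux : ∀ (g : G) (u : ℤˣ) (z : HNNExtension G A B φ), (letters φ d z).length ≤ n →
          (letters φ d (of g * (t ^ (u : ℤ) * z))).length ≤ n + 1 := by
        intro g u z hz
        have := length_zpow_mul_of u g z d
        omega
      have hne : letters φ d x ≠ letters φ d y := by
        intro h
        rw [h, List.suffixDist_self] at hn
        omega
      rcases List.suffixDist_cons_or _ _ hne with ⟨a, k, hx, hk⟩ | ⟨a, k, hy, hk⟩
      · obtain ⟨g, z, rfl, rfl⟩ := exists_of_mul_zpow_mul hx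
        rw [mul_assoc, mul_assoc]
        exact aux _ _ _ (ih z y (by omega))
      · obtain ⟨g, z, rfl, rfl⟩ := exists_of_mul_zpow_mul hy
        have h1 := ih x z (by omega)
        rw [← length_letters_inv, mul_inv_rev, inv_inv] at h1 ⊢
        rw [mul_assoc, mul_assoc]
        exact aux _ _ _ h1
  · simpa using suffixDist_letters_le (d := d) (x * y⁻¹) y

/-- The exponent sum of the stable letter. -/
noncomputable def exponentSum : HNNExtension G A B φ →* Multiplicative ℤ :=
  lift 1 (Multiplicative.ofAdd 1) (by simp)

/-- The exponent sum is a homomorphism, so it makes the parity of the length additive and excludes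
inversions. -/
lemma even_length_add_exponentSum (x : HNNExtension G A B φ) :
    Even (((letters φ d x).length : ℤ) + (exponentSum x).toAdd) := by
  induction hl : letters φ d x generalizing x with
  | nil =>
    obtain ⟨g, rfl⟩ := exists_eq_of_of_letters_eq_nil hl
    simp [exponentSum]
  | cons a l ih =>
    obtain ⟨g, z, rfl, hz⟩ := exists_of_mul_zpow_mul hl
    have h := ih z hz
    have e : (exponentSum (of g * (t ^ (a.1 : ℤ) * z))).toAdd
        = (a.1 : ℤ) + (exponentSum z).toAdd := by
      simp [exponentSum]
    rw [e, List.length_cons]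
    push_cast
    rcases Int.units_eq_one_or a.1 with h1 | h1 <;> rw [h1] <;> push_cast <;> grind

lemma length_of (g : G) : length φ (of g) = 0 := by
  rw [length, ← mul_one (of g), letters_of_mul, letters_one, List.length_nil]

lemma exists_eq_of_of_length_eq_zero {x : HNNExtension G A B φ} (h : length φ x = 0) :
    ∃ g, x = of g :=
  exists_eq_of_of_letters_eq_nil (List.length_eq_zero_iff.1 h)

lemma exists_of_length_eq_succ {x : HNNExtension G A B φ} {n : ℕ} (h : length φ x = n + 1) :
    ∃ (g : G) (u : ℤˣ) (y : HNNExtension G A B φ), x = of g * (t ^ (u : ℤ) * y) ∧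
      length φ y = n := by
  obtain ⟨a, l, hl, hn⟩ := List.length_eq_succ_iff.1 h
  obtain ⟨g, y, rfl, hy⟩ := exists_of_mul_zpow_mul hl.symm
  exact ⟨g, a.1, y, rfl, by rw [length, hy, hn]⟩

lemma length_reducedWord (w : NormalWord.ReducedWord G A B) :
    length φ (w.prod φ) = w.toList.length := by
  obtain ⟨w', h1, h2, -⟩ := ReducedWord.exists_normalWord_prod_eq φ
    (Classical.arbitrary (NormalWord.TransversalPair G A B)) w
  rw [length, ← h1, letters_eq_of_prod]
  simpa using congrArg List.length h2

theorem isTreeLength : IsTreeLength (length φ) where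
  one := by rw [← map_one of, length_of]
  inv x := length_letters_inv x
  four_point x y z := by
    have h : ∀ a b : HNNExtension G A B φ, length φ (a⁻¹ * b) =
        (letters φ (Classical.arbitrary _) a⁻¹).suffixDist
          (letters φ (Classical.arbitrary _) b⁻¹) := by
      intro a b
      rw [← length_letters_mul_inv, inv_inv, length]
    have h' : ∀ a : HNNExtension G A B φ, length φ a =
        (letters φ (Classical.arbitrary _) a⁻¹).length := fun a => (length_letters_inv a).symm
    rw [h, h, h, h' x, h' y, h' z]
    exact List.suffixDist_four_point _ _ _
  exists_first y n hy := by
    obtain ⟨g, u, z, rfl, hz⟩ := exists_of_length_eq_succ hy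
    refine ⟨of g * t ^ (u : ℤ), ?_, by rw [← hz]; congr 1; group⟩
    have := length_reducedWord (φ := φ) ⟨g, [(u, 1)], List.isChain_singleton _⟩
    simpa [NormalWord.ReducedWord.prod] using this
  even_mul x y := by
    have h1 := even_length_add_exponentSum (d := Classical.arbitrary _) x
    have h2 := even_length_add_exponentSum (d := Classical.arbitrary _) y
    have h3 := even_length_add_exponentSum (d := Classical.arbitrary _) (x * y)
    rw [map_mul, toAdd_mul] at h3
    change Even ((length φ x : ℤ) + _) at h1
    change Even ((length φ y : ℤ) + _) at h2
    change Even ((length φ (x * y) : ℤ) + _) at h3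
    have h4 : Even ((length φ (x * y) : ℤ) + length φ x + length φ y) := by grind
    exact_mod_cast h4
  sq_ne_zero y hy h := by
    have h1 := even_length_add_exponentSum (d := Classical.arbitrary _) y
    obtain ⟨g, hg⟩ := exists_eq_of_of_length_eq_zero h
    have h2 := congrArg (fun x => (exponentSum x).toAdd) hg
    simp [exponentSum] at h2
    have h3 : (exponentSum y).toAdd = 0 := by simpa [exponentSum] using h2
    change Even ((length φ y : ℤ) + _) at h1
    rw [hy, h3] at h1
    simp at h1

/-- Britton's lemma: otherwise the word would be reduced, of length 2. -/
lemma mem_toSubgroup_of_length_eq_zero (u : ℤˣ) (g : G)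
    (h : length φ (t ^ (u : ℤ) * of g * t ^ (-(u : ℤ))) = 0) : g ∈ toSubgroup A B u := by
  by_contra hg
  have := length_reducedWord (φ := φ) ⟨1, [(u, g), (-u, 1)], by simp [hg]⟩
  simp [NormalWord.ReducedWord.prod] at this
  rw [zpow_neg, this] at h
  omega

lemma length_zpow_mul_of_mul_zpow (u : ℤˣ) (g : G) (h : g ∈ toSubgroup A B u) :
    length φ (t ^ (u : ℤ) * of g * t ^ (-(u : ℤ))) = 0 := by
  rcases Int.units_eq_one_or u with rfl | rfl
  · have := equiv_eq_conj (φ := φ) ⟨g, h⟩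
    simp only [Units.val_one, zpow_one, zpow_neg]
    rw [← this, length_of]
  · have := equiv_symm_eq_conj (φ := φ) ⟨g, h⟩
    simp only [Units.val_neg, Units.val_one, zpow_one, zpow_neg, neg_neg]
    rw [← this, length_of]

/-- Squaring is injective on an HNN extension if the associated subgroups are closed under square
roots and two elements with the same square that differ by an element of the base group are
equal. -/
theorem mul_self_injective (hA : ∀ g : G, g * g ∈ A → g ∈ A) (hB : ∀ g : G, g * g ∈ B → g ∈ B)
    (vert : ∀ (y : HNNExtension G A B φ) (g : G), y * y = (y * of g) * (y * of g) → g = 1)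
    (y z : HNNExtension G A B φ) (h : y * y = z * z) : y = z := by
  refine isTreeLength.mul_self_injective ?_ ?_ y z h
  · intro s u hs hu h
    obtain ⟨g, rfl⟩ := exists_eq_of_of_length_eq_zero hu
    obtain ⟨k, e, s', rfl, hs'⟩ := exists_of_length_eq_succ hs
    obtain ⟨m, rfl⟩ := exists_eq_of_of_length_eq_zero hs'
    -- Factors from the base group do not change the length, so only the edge given by a single
    -- stable letter matters.
    have aux : ∀ x : G, length φ (of k * (t ^ (e : ℤ) * of m) * of x *
        (of k * (t ^ (e : ℤ) * of m))⁻¹) =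
          length φ (t ^ (e : ℤ) * of (m * x * m⁻¹) * t ^ (-(e : ℤ))) := by
      intro x
      have : of k * (t ^ (e : ℤ) * of m) * of x * (of k * (t ^ (e : ℤ) * of m))⁻¹ =
          of k * (t ^ (e : ℤ) * of (m * x * m⁻¹) * t ^ (-(e : ℤ))) * (of k⁻¹ :
            HNNExtension G A B φ) := by
        simp only [map_mul, map_inv]
        group
      rw [this, isTreeLength.mul_right_eq _ (length_of _), isTreeLength.mul_left_eq (length_of _)]
    rw [← map_mul, aux] at h
    rw [aux]
    apply length_zpow_mul_of_mul_zpow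
    have h1 := mem_toSubgroup_of_length_eq_zero _ _ h
    have h2 : m * (g * g) * m⁻¹ = (m * g * m⁻¹) * (m * g * m⁻¹) := by group
    rw [h2] at h1
    rcases Int.units_eq_one_or e with rfl | rfl
    · exact hA _ h1
    · exact hB _ h1
  · intro y z hyz h0
    obtain ⟨g, hg⟩ := exists_eq_of_of_length_eq_zero h0
    have hz : z = y * of g := by rw [← hg]; group
    rw [hz] at hyz ⊢
    rw [vert y g hyz, map_one, mul_one]

end HNNExtension

/-! ### HNN extensions along infinite cyclic subgroups -/

namespace HNNExtension

variable {H : Type*} [Group H]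

lemma zpowersHom_injective {x : H} (hx : ¬ IsOfFinOrder x) :
    Function.Injective (zpowersHom H x) := by
  intro m n hmn
  exact Multiplicative.toAdd.injective
    (injective_zpow_iff_not_isOfFinOrder.2 hx (by simpa using hmn))

/-- The isomorphism of infinite cyclic subgroups that takes `x` to `y`. -/
noncomputable def cyclicEquiv {x y : H} (hx : ¬ IsOfFinOrder x) (hy : ¬ IsOfFinOrder y) :
    (zpowersHom H x).range ≃* (zpowersHom H y).range :=
  (MonoidHom.ofInjective (zpowersHom_injective hx)).symm.trans
    (MonoidHom.ofInjective (zpowersHom_injective hy))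

lemma cyclicEquiv_apply {x y : H} (hx : ¬ IsOfFinOrder x) (hy : ¬ IsOfFinOrder y)
    (n : Multiplicative ℤ) :
    (cyclicEquiv hx hy ⟨zpowersHom H x n, n, rfl⟩ : H) = zpowersHom H y n := by
  have : (MonoidHom.ofInjective (zpowersHom_injective hx)).symm ⟨zpowersHom H x n, n, rfl⟩ = n :=
    (MulEquiv.symm_apply_eq _).2 rfl
  simp only [cyclicEquiv, MulEquiv.trans_apply, this]
  rfl

/-- The HNN extension with stable letter `t` and the relation `t * x * t⁻¹ = y`. -/
abbrev Cyclic {x y : H} (hx : ¬ IsOfFinOrder x) (hy : ¬ IsOfFinOrder y) : Type _ :=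
  HNNExtension H _ _ (cyclicEquiv hx hy)

variable {x y : H} {hx : ¬ IsOfFinOrder x} {hy : ¬ IsOfFinOrder y}

lemma Cyclic.t_mul_of : (t : Cyclic hx hy) * of x = of y * t := by
  have h := HNNExtension.t_mul_of (φ := cyclicEquiv hx hy)
    ⟨zpowersHom H x (Multiplicative.ofAdd 1), _, rfl⟩
  rw [cyclicEquiv_apply] at h
  simpa using h

/-- The homomorphism out of `HNNExtension.Cyclic` given by the images of the base group and of the
stable letter. -/
noncomputable def Cyclic.lift {K : Type*} [Group K] (f : H →* K) (s : K)
    (hs : s * f x = f y * s) : Cyclic hx hy →* K :=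
  HNNExtension.lift f s <| by
    rintro ⟨_, n, rfl⟩
    rw [cyclicEquiv_apply]
    have : SemiconjBy s (f x) (f y) := hs
    simpa [zpowersHom_apply] using (this.zpow_right n.toAdd).eq

@[simp]
lemma Cyclic.lift_of {K : Type*} [Group K] (f : H →* K) (s : K) (hs : s * f x = f y * s) (g : H) :
    Cyclic.lift (hx := hx) (hy := hy) f s hs (of g) = f g := HNNExtension.lift_of ..

@[simp]
lemma Cyclic.lift_t {K : Type*} [Group K] (f : H →* K) (s : K) (hs : s * f x = f y * s) :
    Cyclic.lift (hx := hx) (hy := hy) f s hs t = s := HNNExtension.lift_t ..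

end HNNExtension

/-! ### Universal properties of the presented groups -/

namespace NoBottle

open HNNExtension Multiplicative

lemma map_conj {G K : Type*} [Group G] [Group K] (f : G →* K) (x y : G) :
    f (conj x y) = conj (f x) (f y) := by simp [conj]

lemma map_comm {G K : Type*} [Group G] [Group K] (f : G →* K) (x y : G) :
    f (comm x y) = comm (f x) (f y) := by simp [comm]

lemma comm_eq_one_iff {G : Type*} [Group G] (x y : G) : comm x y = 1 ↔ x * y = y * x := by
  rw [comm, mul_assoc, show x⁻¹ * y⁻¹ = (y * x)⁻¹ by group, inv_mul_eq_one, eq_comm]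

/-- The homomorphism out of `BS(n, m)` given by the images of the generators. -/
def BS.lift {K : Type*} [Group K] {n m : ℤ} (c d : K) (hcd : conj (c ^ n) d = c ^ m) :
    BS n m →* K :=
  PresentedGroup.toGroup (f := ![c, d]) <| by
    rintro r rfl
    simp only [map_mul, map_conj, map_zpow, map_inv, FreeGroup.lift_apply_of]
    exact mul_inv_eq_one.2 hcd

@[simp]
lemma BS.lift_c {K : Type*} [Group K] {n m : ℤ} (c d : K) (hcd : conj (c ^ n) d = c ^ m) :
    BS.lift c d hcd (BS.c n m) = c := PresentedGroup.toGroup.of _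

@[simp]
lemma BS.lift_d {K : Type*} [Group K] {n m : ℤ} (c d : K) (hcd : conj (c ^ n) d = c ^ m) :
    BS.lift c d hcd (BS.d n m) = d := PresentedGroup.toGroup.of _

lemma BS.rel (n m : ℤ) : conj (BS.c n m ^ n) (BS.d n m) = BS.c n m ^ m := by
  have := PresentedGroup.one_of_mem (rels := ({conj (FreeGroup.of 0 ^ n) (FreeGroup.of 1) *
    (FreeGroup.of 0 ^ m)⁻¹} : Set (FreeGroup (Fin 2)))) rfl
  simp only [map_mul, map_conj, map_zpow, map_inv] at this
  exact mul_inv_eq_one.1 this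

lemma BS.hom_ext {K : Type*} [Group K] {n m : ℤ} {f g : BS n m →* K}
    (hc : f (BS.c n m) = g (BS.c n m)) (hd : f (BS.d n m) = g (BS.d n m)) : f = g :=
  PresentedGroup.ext fun i => by fin_cases i <;> assumption

/-- The homomorphism out of `⟨a, b | [a, b] = 1⟩` given by the images of the generators. -/
def FreeAb.lift {K : Type*} [Group K] (a b : K) (hab : a * b = b * a) : FreeAb →* K :=
  PresentedGroup.toGroup (f := ![a, b]) <| by
    rintro r rfl
    simp only [map_comm, FreeGroup.lift_apply_of]
    exact (comm_eq_one_iff _ _).2 hab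

@[simp]
lemma FreeAb.lift_a {K : Type*} [Group K] (a b : K) (hab : a * b = b * a) :
    FreeAb.lift a b hab FreeAb.a = a := PresentedGroup.toGroup.of _

@[simp]
lemma FreeAb.lift_b {K : Type*} [Group K] (a b : K) (hab : a * b = b * a) :
    FreeAb.lift a b hab FreeAb.b = b := PresentedGroup.toGroup.of _

lemma FreeAb.a_mul_b : FreeAb.a * FreeAb.b = FreeAb.b * FreeAb.a := by
  have := PresentedGroup.one_of_mem (rels := ({comm (FreeGroup.of 0) (FreeGroup.of 1)} :
    Set (FreeGroup (Fin 2)))) rfl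
  rw [map_comm, comm_eq_one_iff] at this
  exact this

lemma FreeAb.hom_ext {K : Type*} [Group K] {f g : FreeAb →* K}
    (ha : f FreeAb.a = g FreeAb.a) (hb : f FreeAb.b = g FreeAb.b) : f = g :=
  PresentedGroup.ext fun i => by fin_cases i <;> assumption

/-- The homomorphism out of `G` given by the images of the generators. -/
def G.lift {K : Type*} [Group K] (a c d : K) (ha : a * comm (conj c d) c = comm (conj c d) c * a)
    (hcd : conj (c ^ 3) d = c ^ 5) : G →* K :=
  PresentedGroup.toGroup (f := ![a, c, d]) <| by
    rintro r (rfl | rfl)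
    · simp only [map_comm, map_conj, FreeGroup.lift_apply_of]
      exact (comm_eq_one_iff _ _).2 ha
    · simp only [map_mul, map_conj, map_pow, map_inv, FreeGroup.lift_apply_of]
      exact mul_inv_eq_one.2 hcd

section

variable {K : Type*} [Group K] (a c d : K) (ha : a * comm (conj c d) c = comm (conj c d) c * a)
    (hcd : conj (c ^ 3) d = c ^ 5)

@[simp]
lemma G.lift_a : G.lift a c d ha hcd G.a = a := PresentedGroup.toGroup.of _

@[simp]
lemma G.lift_c : G.lift a c d ha hcd G.c = c := PresentedGroup.toGroup.of _

@[simp]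
lemma G.lift_d : G.lift a c d ha hcd G.d = d := PresentedGroup.toGroup.of _

end

lemma G.hom_ext {K : Type*} [Group K] {f g : G →* K} (ha : f G.a = g G.a)
    (hc : f G.c = g G.c) (hd : f G.d = g G.d) : f = g :=
  PresentedGroup.ext fun i => by fin_cases i <;> assumption

lemma G.rel_a : G.a * comm (conj G.c G.d) G.c = comm (conj G.c G.d) G.c * G.a := by
  have := PresentedGroup.one_of_mem (rels := ({comm (FreeGroup.of 0)
        (comm (conj (FreeGroup.of 1) (FreeGroup.of 2)) (FreeGroup.of 1)),
      conj (FreeGroup.of 1 ^ 3) (FreeGroup.of 2) * (FreeGroup.of 1 ^ 5)⁻¹} :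
      Set (FreeGroup (Fin 3)))) (Or.inl rfl)
  rw [map_comm, comm_eq_one_iff, map_comm, map_conj] at this
  exact this

lemma G.rel_c : conj (G.c ^ 3) G.d = G.c ^ 5 := by
  have := PresentedGroup.one_of_mem (rels := ({comm (FreeGroup.of 0)
        (comm (conj (FreeGroup.of 1) (FreeGroup.of 2)) (FreeGroup.of 1)),
      conj (FreeGroup.of 1 ^ 3) (FreeGroup.of 2) * (FreeGroup.of 1 ^ 5)⁻¹} :
      Set (FreeGroup (Fin 3)))) (Or.inr rfl)
  simp only [map_mul, map_conj, map_pow, map_inv] at this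
  exact mul_inv_eq_one.1 this

/-- The homomorphism `BS(3, 5) → G` that keeps the names of the generators. -/
def G.ofBS : BS 3 5 →* G := BS.lift G.c G.d (by exact_mod_cast G.rel_c)

/-! ### Unique square roots in `BS(3, 5)` -/

lemma not_isOfFinOrder_ofAdd {n : ℤ} (hn : n ≠ 0) : ¬ IsOfFinOrder (ofAdd n) := by
  rw [isOfFinOrder_iff_pow_eq_one]
  rintro ⟨k, hk, h⟩
  have := congrArg toAdd h
  simp [hn] at this
  omega

/-- `BS(3, 5)` as an HNN extension of the infinite cyclic group. -/
abbrev BSHNN : Type :=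
  Cyclic (not_isOfFinOrder_ofAdd (n := 5) (by norm_num))
    (not_isOfFinOrder_ofAdd (n := 3) (by norm_num))

/-- The comparison map from the presented group to the HNN extension. -/
noncomputable def BS.toHNN : BS 3 5 →* BSHNN :=
  BS.lift (of (ofAdd 1)) t <| by
    -- The defining relation reads `d * c ^ 5 * d⁻¹ = c ^ 3`, hence 5 before 3 in `BSHNN`.
    have h : (t : BSHNN) * of (ofAdd 5) = of (ofAdd 3) * t := Cyclic.t_mul_of
    have e : ∀ k : ℤ, (of (ofAdd k) : BSHNN) = of (ofAdd 1) ^ k := fun k => by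
      rw [← map_zpow, ← ofAdd_zsmul, zsmul_one, Int.cast_id]
    rw [e 5, e 3] at h
    rw [conj, mul_assoc, inv_mul_eq_iff_eq_mul, h]

lemma BS.toHNN_injective : Function.Injective BS.toHNN := by
  let f : BSHNN →* BS 3 5 := Cyclic.lift (zpowersHom _ (BS.c 3 5)) (BS.d 3 5) <| by
    have h := BS.rel 3 5
    rw [conj, mul_assoc, inv_mul_eq_iff_eq_mul] at h
    simpa using h.symm
  have h : f.comp BS.toHNN = MonoidHom.id _ := by
    apply BS.hom_ext <;> simp [f, BS.toHNN]
  exact Function.LeftInverse.injective (g := f) (DFunLike.congr_fun h)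

/-- Multiplication by `3 / 5`. -/
def scaling : ℚ ≃o ℚ := OrderIso.mulRight₀ (3 / 5 : ℚ) (by norm_num)

/-- The translations by integers. -/
def translation : Multiplicative ℤ →* (ℚ ≃o ℚ) where
  toFun n := OrderIso.addRight (n.toAdd : ℚ)
  map_one' := by ext; simp
  map_mul' m n := by ext q; simp [add_comm, add_left_comm]

/-- The action of `BS(3, 5)` on the rational line by affine maps. -/
noncomputable def affine : BSHNN →* (ℚ ≃o ℚ) :=
  Cyclic.lift translation scaling <| by
    ext q
    simp [scaling, translation]
    ring

@[simp]
lemma affine_of (n : Multiplicative ℤ) (q : ℚ) : affine (of n) q = q + n.toAdd := by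
  simp [affine, translation]

@[simp]
lemma affine_t (q : ℚ) : affine t q = q * (3 / 5) := by
  simp [affine, scaling]

@[simp]
lemma affine_t_inv (q : ℚ) : affine t⁻¹ q = q * (5 / 3) := by
  have h := congrArg (fun f => f (q * (5 / 3))) (map_mul affine t⁻¹ t)
  simp only [inv_mul_cancel, map_one, RelIso.mul_apply, affine_t] at h
  rw [show q * (5 / 3) * (3 / 5) = q by ring] at h
  exact h.symm

lemma mem_range_ofAdd {n : ℤ} (g : Multiplicative ℤ) :
    g ∈ (zpowersHom (Multiplicative ℤ) (ofAdd n)).range ↔ n ∣ g.toAdd := by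
  constructor
  · rintro ⟨k, rfl⟩
    exact ⟨k.toAdd, by simp [mul_comm]⟩
  · rintro ⟨k, hk⟩
    exact ⟨ofAdd k, toAdd.injective (by simp [hk, mul_comm])⟩

/-- Doubling preserves non-divisibility by 3 and by 5. If `y` and `y * of g` have the same square,
then `y = of g * y * of g`; since `y` acts on `ℚ` as an increasing map, the translation by `g` must
be trivial. -/
lemma BSHNN.mul_self_injective (y z : BSHNN) (h : y * y = z * z) : y = z := by
  refine HNNExtension.mul_self_injective ?_ ?_ ?_ y z h
  · intro g
    simp only [mem_range_ofAdd, toAdd_mul]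
    omega
  · intro g
    simp only [mem_range_ofAdd, toAdd_mul]
    omega
  · intro y g hy
    have h1 : y = of g * (y * of g) := by
      rw [mul_assoc, mul_right_inj] at hy
      exact hy
    have h2 := congrArg (fun f => f (0 : ℚ)) (congrArg affine h1)
    simp only [map_mul, RelIso.mul_apply, affine_of] at h2
    rw [zero_add] at h2
    have h3 : (0 : ℚ) = g.toAdd := by
      rcases lt_trichotomy (0 : ℚ) g.toAdd with hlt | heq | hlt
      · have := (affine y).lt_iff_lt.2 hlt
        linarith
      · exact heq
      · have := (affine y).lt_iff_lt.2 hlt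
        linarith
    exact toAdd.injective (by exact_mod_cast h3.symm)

lemma BS.mul_self_injective (y z : BS 3 5) (h : y * y = z * z) : y = z :=
  BS.toHNN_injective (BSHNN.mul_self_injective _ _ (by rw [← map_mul, h, map_mul]))

/-- A word in the letters `t ^ u * of (ofAdd k)` with `k = ± 1` is reduced. -/
lemma BSHNN.length_prod (g : Multiplicative ℤ) (l : List (ℤˣ × ℤ))
    (hl : ∀ a ∈ l, a.2 = 1 ∨ a.2 = -1) :
    length (cyclicEquiv _ _) (of g * (l.map fun a => t ^ (a.1 : ℤ) * of (ofAdd a.2)).prod :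
      BSHNN) = l.length := by
  have key : (l.map fun a => (a.1, ofAdd a.2)).IsChain (fun a b =>
      a.2 ∈ toSubgroup (zpowersHom (Multiplicative ℤ) (ofAdd 5)).range
        (zpowersHom (Multiplicative ℤ) (ofAdd 3)).range a.1 → a.1 = b.1) := by
    rw [List.isChain_map]
    refine List.IsChain.imp_of_mem_imp (R := fun _ _ => True) ?_ ?_
    · intro a b ha hb _ hmem
      exfalso
      have h := hl a ha
      rcases Int.units_eq_one_or a.1 with h1 | h1 <;> rw [h1] at hmem <;>
        simp only [toSubgroup_one, toSubgroup_neg_one, mem_range_ofAdd, toAdd_ofAdd] at hmem <;>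
        omega
    · exact (List.pairwise_of_forall fun _ _ => trivial).isChain
  have := length_reducedWord (φ := cyclicEquiv (not_isOfFinOrder_ofAdd (n := 5) (by norm_num))
    (not_isOfFinOrder_ofAdd (n := 3) (by norm_num))) ⟨g, _, key⟩
  simpa [NormalWord.ReducedWord.prod, Function.comp_def] using this

/-! ### The element `[c ^ d, c]` is not a square -/

lemma toHNN_h : BS.toHNN h = t⁻¹ * of (ofAdd (-1)) * t * of (ofAdd (-1)) *
    t⁻¹ * of (ofAdd 1) * t * of (ofAdd 1) := by
  rw [h, map_comm, map_conj]
  simp only [BS.toHNN, BS.lift_c, BS.lift_d, comm, conj, ofAdd_neg, map_inv]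
  group

/-- The base point lies on the axis of `h`, which translates by 4. A root `v` would send it to the
midpoint `t⁻¹ * c⁻¹ * t`, so `v = t⁻¹ * c⁻¹ * t * of g`. On `ℚ` this is the translation by `g - 5 /
3`, while `h` acts trivially as a commutator of translations; no integer `g` satisfies `2 * (g - 5 /
3) = 0`. -/
lemma h_ne_mul_self (v : BS 3 5) : v * v ≠ h := by
  intro hv
  replace hv := congrArg BS.toHNN hv
  rw [map_mul, toHNN_h] at hv
  generalize BS.toHNN v = v at hv
  set c : BSHNN := of (ofAdd 1) with hc
  have hc' : (of (ofAdd (-1)) : BSHNN) = c⁻¹ := by rw [ofAdd_neg, map_inv]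
  rw [hc'] at hv
  have T := isTreeLength (φ := cyclicEquiv (not_isOfFinOrder_ofAdd (n := 5) (by norm_num))
    (not_isOfFinOrder_ofAdd (n := 3) (by norm_num)))
  set L := length (cyclicEquiv (not_isOfFinOrder_ofAdd (n := 5) (by norm_num))
    (not_isOfFinOrder_ofAdd (n := 3) (by norm_num)))
  have h4 : L (v * v) = 4 := by
    have := BSHNN.length_prod 1 [(-1, -1), (1, -1), (-1, 1), (1, 1)] (by simp)
    simp [← hc] at this
    rw [hv, ← this]
    exact congrArg L (by group)
  have h8 : L ((v * v) * (v * v)) = 8 := by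
    have := BSHNN.length_prod 1 [(-1, -1), (1, -1), (-1, 1), (1, 1), (-1, -1), (1, -1), (-1, 1),
      (1, 1)] (by simp)
    simp [← hc] at this
    rw [hv, ← this]
    exact congrArg L (by group)
  have hp : L (t⁻¹ * c⁻¹ * t) = 2 := by
    have := BSHNN.length_prod 1 [(-1, -1), (1, -1)] (by simp)
    simp [← hc] at this
    rw [← T.mul_right_eq _ (show L c⁻¹ = 0 from hc' ▸ length_of _), ← this]
    exact congrArg L (by group)
  have hp' : L ((t⁻¹ * c⁻¹ * t)⁻¹ * (v * v)) = 2 := by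
    have := BSHNN.length_prod (ofAdd (-1)) [(-1, 1), (1, 1)] (by simp)
    simp [← hc] at this
    rw [hv, ← this]
    exact congrArg L (by group)
  have hv2 : L v = 2 := T.sqrt_length (by norm_num) h4 h8
  have h0 := T.inv_mul_eq_zero (w := v * v) h4 hp hv2 hp' (by rw [inv_mul_cancel_left, hv2])
  obtain ⟨g, hg⟩ := exists_eq_of_of_length_eq_zero h0
  rw [inv_mul_eq_iff_eq_mul] at hg
  have h1 := congrArg (fun f => f (0 : ℚ)) (congrArg affine hv)
  have hcinv : ∀ q, affine c⁻¹ q = q - 1 := by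
    intro q
    rw [← hc', affine_of]
    simp [sub_eq_add_neg]
  rw [hg] at h1
  have hca : ∀ q, affine c q = q + 1 := by
    intro q
    rw [hc, affine_of]
    simp
  simp only [map_mul, RelIso.mul_apply, affine_of, affine_t, affine_t_inv, hcinv, hca] at h1
  have h2 : (6 : ℚ) * g.toAdd = 10 := by
    linarith
  have h3 : 6 * g.toAdd = 10 := by exact_mod_cast h2
  omega

/-- Unique roots halve an even exponent. If `h ^ (2 * m + 1) = 1`, then `h` is the square of `h ^ (m
+ 1)`. -/
lemma not_isOfFinOrder_h : ¬ IsOfFinOrder h := by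
  rw [isOfFinOrder_iff_pow_eq_one]
  rintro ⟨n, hn, h1⟩
  induction n using Nat.strong_induction_on with
  | _ n ih =>
    rcases Nat.even_or_odd' n with ⟨m, rfl | rfl⟩
    · refine ih m (by omega) (by omega) (BS.mul_self_injective _ _ ?_)
      rw [← pow_add, ← two_mul, h1, one_mul]
    · refine h_ne_mul_self (h ^ (m + 1)) ?_
      rw [← pow_add, show m + 1 + (m + 1) = 2 * m + 1 + 1 by ring, pow_succ, h1, one_mul]

lemma mem_zpowers_h_of_mul_self (u : BS 3 5) (hu : u * u ∈ (zpowersHom (BS 3 5) h).range) :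
    u ∈ (zpowersHom (BS 3 5) h).range := by
  obtain ⟨k, hk⟩ := hu
  rw [zpowersHom_apply] at hk
  rcases Int.even_or_odd' k.toAdd with ⟨m, hm | hm⟩
  · refine ⟨ofAdd m, BS.mul_self_injective _ _ ?_⟩
    rw [← hk, hm, zpowersHom_apply, toAdd_ofAdd, ← zpow_add, two_mul]
  · exfalso
    -- Since `u * u` is a power of `h`, conjugation by `h` fixes it, and unique roots make it fix
    -- `u`. Then `u * h ^ (-m)` is a square root of `h`.
    have hcomm : h * u * h⁻¹ = u := by
      apply BS.mul_self_injective
      calc h * u * h⁻¹ * (h * u * h⁻¹) = h * (u * u) * h⁻¹ := by group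
        _ = u * u := by rw [← hk]; group
    have hc : Commute u h := by
      rw [mul_inv_eq_iff_eq_mul] at hcomm
      exact hcomm.symm
    apply h_ne_mul_self (u * h ^ (-m))
    have hc' := hc.zpow_right (-m)
    calc u * h ^ (-m) * (u * h ^ (-m)) = u * (h ^ (-m) * u) * h ^ (-m) := by group
      _ = u * u * (h ^ (-m) * h ^ (-m)) := by rw [← hc'.eq]; group
      _ = h := by
        rw [← hk, hm, ← zpow_add, ← zpow_add]
        ring_nf
        exact zpow_one _

/-! ### Unique square roots in `G` -/

/-- `G` as an HNN extension of `BS(3, 5)`. -/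
abbrev GHNN : Type := Cyclic not_isOfFinOrder_h not_isOfFinOrder_h

/-- The retraction `r` kills the stable letter and is the identity on the base group, so the
base-group ambiguity is settled by unique roots in `BS(3, 5)`. -/
lemma GHNN.mul_self_injective (y z : GHNN) (h : y * y = z * z) : y = z := by
  refine HNNExtension.mul_self_injective mem_zpowers_h_of_mul_self mem_zpowers_h_of_mul_self
    ?_ y z h
  intro y g hy
  let r : GHNN →* BS 3 5 := Cyclic.lift (MonoidHom.id _) 1 (by simp)
  have hr := BS.mul_self_injective (r y) (r y * g) (by simpa [r] using congrArg r hy)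
  simpa using hr

/-- The comparison map from the presented group to the HNN extension. -/
noncomputable def G.toHNN : G →* GHNN :=
  G.lift t (of (BS.c 3 5)) (of (BS.d 3 5))
    (by
      have e : (of h : GHNN) = comm (conj (of (BS.c 3 5)) (of (BS.d 3 5))) (of (BS.c 3 5)) :=
        (map_comm of _ _).trans (by rw [map_conj])
      rw [← e]
      exact Cyclic.t_mul_of)
    (by
      rw [← map_pow, ← map_pow, ← map_conj]
      exact congrArg of (by exact_mod_cast BS.rel 3 5))

lemma G.ofBS_h : G.ofBS h = comm (conj G.c G.d) G.c := by
  simp [h, map_comm, map_conj, G.ofBS]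

lemma G.toHNN_injective : Function.Injective G.toHNN := by
  let f : GHNN →* G := Cyclic.lift G.ofBS G.a (by rw [G.ofBS_h]; exact G.rel_a)
  have hf : f.comp G.toHNN = MonoidHom.id _ := by
    apply G.hom_ext <;> simp [f, G.toHNN, G.ofBS]
  exact Function.LeftInverse.injective (g := f) (DFunLike.congr_fun hf)

lemma G.mul_self_injective (y z : G) (h : y * y = z * z) : y = z :=
  G.toHNN_injective (GHNN.mul_self_injective _ _ (by rw [← map_mul, h, map_mul]))

/-! ### Excluding the Klein-bottle group -/

lemma KleinBottleGroup.c_ne_one : BS.c 1 (-1) ≠ 1 := by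
  intro hc
  let f : KleinBottleGroup →* Multiplicative (ZMod 2) := BS.lift (ofAdd 1) 1 (by decide)
  have := congrArg f hc
  simp [f] at this

lemma not_isOfFinOrder_b : ¬ IsOfFinOrder FreeAb.b := by
  intro hb
  have := (FreeAb.lift (1 : Multiplicative ℤ) (ofAdd 1) (by simp)).isOfFinOrder hb
  rw [FreeAb.lift_b] at this
  exact not_isOfFinOrder_ofAdd one_ne_zero this

theorem G.not_exists_kleinBottle : ¬ ∃ S : Subgroup G, Nonempty (S ≃* KleinBottleGroup) := by
  rintro ⟨S, ⟨e⟩⟩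
  let f : KleinBottleGroup →* G := S.subtype.comp e.symm.toMonoidHom
  have hf : Function.Injective f := S.subtype_injective.comp e.symm.injective
  have hrel := congrArg f (BS.rel 1 (-1))
  simp only [map_conj, zpow_one, zpow_neg, map_inv] at hrel
  -- The relation becomes `c * d * c = d`, whence `(d * c) * (d * c) = d * d`.
  rw [conj, mul_assoc, inv_mul_eq_iff_eq_mul, eq_mul_inv_iff_mul_eq] at hrel
  have h := G.mul_self_injective (f (BS.d 1 (-1)) * f (BS.c 1 (-1))) (f (BS.d 1 (-1))) (by
    rw [mul_assoc, ← mul_assoc (f (BS.c 1 (-1))), hrel])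
  rw [mul_eq_left] at h
  exact KleinBottleGroup.c_ne_one (hf (h.trans (map_one f).symm))

/-! ### `G` as an amalgamated free product -/

lemma CyclicAmalgam.inl_eq_inr {A B : Type} [Group A] [Group B] (x : A) (y : B) :
    CyclicAmalgam.inl x y x = CyclicAmalgam.inr x y y := by
  have h1 := Monoid.PushoutI.of_apply_eq_base (cyclicMaps x y) false (ofAdd 1)
  have h2 := Monoid.PushoutI.of_apply_eq_base (cyclicMaps x y) true (ofAdd 1)
  have e1 : cyclicMaps x y false (ofAdd 1) = x := by
    change zpowersHom A x (ofAdd 1) = x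
    simp
  have e2 : cyclicMaps x y true (ofAdd 1) = y := by
    change zpowersHom B y (ofAdd 1) = y
    simp
  rw [e1] at h1
  rw [e2] at h2
  exact h1.trans h2.symm

/-- The homomorphism out of an amalgam over a cyclic group given by its restrictions to the
factors. -/
noncomputable def CyclicAmalgam.lift {A B K : Type} [Group A] [Group B] [Group K] {x : A} {y : B}
    (f : A →* K) (g : B →* K) (hfg : f x = g y) : CyclicAmalgam x y →* K :=
  Monoid.PushoutI.lift (fun | false => f | true => g) (zpowersHom K (f x)) <| by
    rintro (_ | _)
    · refine MonoidHom.ext_mint ?_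
      change f (zpowersHom A x (ofAdd 1)) = _
      simp
    · refine MonoidHom.ext_mint ?_
      change g (zpowersHom B y (ofAdd 1)) = _
      simp [hfg]

section

variable {A B K : Type} [Group A] [Group B] [Group K] {x : A} {y : B}

@[simp]
lemma CyclicAmalgam.lift_inl (f : A →* K) (g : B →* K) (hfg : f x = g y) (a : A) :
    CyclicAmalgam.lift f g hfg (CyclicAmalgam.inl x y a) = f a :=
  Monoid.PushoutI.lift_of _ _ _ _

@[simp]
lemma CyclicAmalgam.lift_inr (f : A →* K) (g : B →* K) (hfg : f x = g y) (b : B) :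
    CyclicAmalgam.lift f g hfg (CyclicAmalgam.inr x y b) = g b :=
  Monoid.PushoutI.lift_of _ _ _ _

lemma CyclicAmalgam.hom_ext {f g : CyclicAmalgam x y →* K}
    (hl : f.comp (CyclicAmalgam.inl x y) = g.comp (CyclicAmalgam.inl x y))
    (hr : f.comp (CyclicAmalgam.inr x y) = g.comp (CyclicAmalgam.inr x y)) : f = g :=
  Monoid.PushoutI.hom_ext_nonempty (by rintro (_ | _) <;> assumption)

end

lemma CyclicAmalgam.inl_b : CyclicAmalgam.inl FreeAb.b h FreeAb.b =
    comm (conj (CyclicAmalgam.inr FreeAb.b h (BS.c 3 5)) (CyclicAmalgam.inr FreeAb.b h (BS.d 3 5)))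
      (CyclicAmalgam.inr FreeAb.b h (BS.c 3 5)) := by
  rw [← map_conj, ← map_comm]
  exact CyclicAmalgam.inl_eq_inr _ _

/-- The isomorphism from `G` onto the amalgam of `⟨a, b | [a, b] = 1⟩` and `BS(3, 5)`. -/
noncomputable def G.equivAmalgam : G ≃* CyclicAmalgam FreeAb.b h :=
  MonoidHom.toMulEquiv
    (G.lift (CyclicAmalgam.inl _ _ FreeAb.a) (CyclicAmalgam.inr _ _ (BS.c 3 5))
      (CyclicAmalgam.inr _ _ (BS.d 3 5))
      (by rw [← CyclicAmalgam.inl_b, ← map_mul, FreeAb.a_mul_b, map_mul])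
      (by
        rw [← map_pow, ← map_pow, ← map_conj]
        exact congrArg _ (by exact_mod_cast BS.rel 3 5)))
    (CyclicAmalgam.lift (FreeAb.lift G.a (comm (conj G.c G.d) G.c) G.rel_a) G.ofBS
      (by rw [FreeAb.lift_b, G.ofBS_h]))
    (by apply G.hom_ext <;> simp [G.ofBS])
    (by
      apply CyclicAmalgam.hom_ext
      · apply FreeAb.hom_ext
        · simp
        · simp only [MonoidHom.comp_apply, CyclicAmalgam.lift_inl, FreeAb.lift_b, map_comm,
            map_conj, G.lift_c, G.lift_d, MonoidHom.id_apply]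
          exact CyclicAmalgam.inl_b.symm
      · apply BS.hom_ext <;> simp [G.ofBS])

end NoBottle

theorem mainTheorem2 :
    -- the data of an amalgamated free product: `b` and `h = [c ^ d, c]` have infinite order
    (¬ IsOfFinOrder NoBottle.FreeAb.b ∧ ¬ IsOfFinOrder NoBottle.h) ∧
    -- the presented group `G` is this amalgamated free product
    (∃ e : NoBottle.G ≃* NoBottle.CyclicAmalgam NoBottle.FreeAb.b NoBottle.h,
      e NoBottle.G.a =
        NoBottle.CyclicAmalgam.inl NoBottle.FreeAb.b NoBottle.h NoBottle.FreeAb.a ∧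
      e NoBottle.G.c =
        NoBottle.CyclicAmalgam.inr NoBottle.FreeAb.b NoBottle.h (NoBottle.BS.c 3 5) ∧
      e NoBottle.G.d =
        NoBottle.CyclicAmalgam.inr NoBottle.FreeAb.b NoBottle.h (NoBottle.BS.d 3 5)) ∧
    -- `G` has no subgroup isomorphic to the Klein-bottle group
    (¬ ∃ S : Subgroup NoBottle.G, Nonempty (S ≃* NoBottle.KleinBottleGroup)) :=
  ⟨⟨NoBottle.not_isOfFinOrder_b, NoBottle.not_isOfFinOrder_h⟩,
    ⟨NoBottle.G.equivAmalgam, by simp [NoBottle.G.equivAmalgam],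
      by simp [NoBottle.G.equivAmalgam], by simp [NoBottle.G.equivAmalgam]⟩,
    NoBottle.G.not_exists_kleinBottle⟩
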